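/- Work in continuous first order logic with truth values in $[0,1]$ ($0$ meaning "true"), with the full system of connectives $\neg x = 1-x$, $\frac{x}{2}$, $x \dot- y = \max(x-y,0)$ and the quantifiers $\sup$ and $\inf$. For a signature in which a binary predicate symbol $d$ is distinguished and in which every symbol carries a uniform continuity modulus for each of its arguments, a structure is a set with an interpretation of every function symbol by an operation and of every predicate symbol by a $[0,1]$-valued function, such that $d$ is a complete metric and all symbols respect their moduli. A theory is a set $T$ of conditions $\varphi = 0$ with $\varphi$ a sentence; its models are the structures in which these sentences have value $0$. Let $\mathcal{L} = \{0, 1, {}^c, \wedge, \vee, \mu\}$ together with the distance symbol $d$, all continuity moduli being the identity. Let $PrA$ be the $\mathcal{L}$-theory consisting of the equational axioms of Boolean algebras (an equation $s = t$ being expressed as $\sup_{\bar x} d(s,t) = 0$) and of $$\mu(1) = 1, \qquad \mu(0) = 0, \qquad \sup_{x,y} \left| \tfrac{\mu(x)+\mu(y)}{2} - \tfrac{\mu(x \vee y)+\mu(x \wedge y)}{2} \right| = 0, \qquad \sup_{x,y} \left| d(x,y) - \mu\big((x \wedge y^c) \vee (y \wedge x^c)\big) \right| = 0.$$ Let $APA$,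 the theory of atomless probability algebras, be $PrA$ together with $$\sup_x \inf_y \left| \mu(y \wedge x) - \tfrac{\mu(x)}{2} \right| = 0 .$$ Then: 1. $APA$ is complete: the set of all sentential conditions that hold in every model of $APA$ is satisfiable, and is maximal among the satisfiable sets of sentential conditions. 2. $APA$ has quantifier elimination: for every $\mathcal{L}$-formula $\varphi(x_0,\dots,x_{n-1})$ and every $\varepsilon > 0$ there is a quantifier-free $\mathcal{L}$-formula $\psi(x_0,\dots,x_{n-1})$ such that $|\varphi^M(\bar a) - \psi^M(\bar a)| \le \varepsilon$ for every model $M$ of $APA$ and every $\bar a \in M^n$. -/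

import Mathlib

universe u

namespace ContLogic

open unitInterval

/-! ### Continuous signatures -/

/-- A (metric) continuous signature: function and predicate symbols with finite arities (a
`FirstOrder.Language`, whose relation symbols are read as predicate symbols), a distinguished
binary distance symbol, and for each symbol and each argument place a continuity modulus
`δ : (0, ∞) → (0, ∞)`, given as a function on `ℝ` of which only the values at `ε > 0` matter. -/
structure Signature extends FirstOrder.Language.{0, 0} where
  distSymb : Relations 2
  modFun : ∀ {n : ℕ}, Functions n → Fin n → ℝ → ℝ
  modRel : ∀ {n : ℕ}, Relations n → Fin n → ℝ → ℝ
  modFun_pos : ∀ {n : ℕ} (f : Functions n) (i : Fin n) (ε : ℝ), 0 < ε → 0 < modFun f i ε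
  modRel_pos : ∀ {n : ℕ} (P : Relations n) (i : Fin n) (ε : ℝ), 0 < ε → 0 < modRel P i ε

/-- Terms of the signature in the variables `x_0, …, x_{n-1}`. -/
abbrev Signature.Tm (S : Signature) (n : ℕ) : Type := S.toLanguage.Term (Fin n)

/-! ### Connectives -/

/-- The connective `x ↦ x / 2` on `[0,1]`. -/
noncomputable def halfI (x : I) : I :=
  ⟨(x : ℝ) / 2, by have := x.2.1; positivity, by have := x.2.2; linarith⟩

/-- The connective truncated subtraction, `(x, y) ↦ max (x - y) 0`, on `[0,1]`. -/
noncomputable def dotminusI (x y : I) : I :=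
  ⟨max ((x : ℝ) - y) 0, le_max_right _ _,
    max_le (by have := x.2.2; have := y.2.1; linarith) zero_le_one⟩

/-! ### Formulae -/

/-- Continuous first order formulae with free variables among `x_0, …, x_{n-1}`, over the full
system of connectives consisting of `¬`, `x / 2` and truncated subtraction. The quantifiers `inf`
and `sup` bind the last variable `x_n` of a formula in `x_0, …, x_n`. -/
inductive Formula (S : Signature) : ℕ → Type
  | atom {n m : ℕ} (P : S.Relations m) (ts : Fin m → S.Tm n) : Formula S n
  | neg {n : ℕ} (φ : Formula S n) : Formula S n
  | half {n : ℕ} (φ : Formula S n) : Formula S n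
  | dotminus {n : ℕ} (φ ψ : Formula S n) : Formula S n
  | inf {n : ℕ} (φ : Formula S (n + 1)) : Formula S n
  | sup {n : ℕ} (φ : Formula S (n + 1)) : Formula S n

/-- Sentences: formulae without free variables. -/
abbrev Sentence (S : Signature) : Type := Formula S 0

namespace Formula

variable {S : Signature}

/-- Quantifier-free formulae. -/
def IsQuantifierFree : ∀ {n : ℕ}, Formula S n → Prop
  | _, atom _ _ => True
  | _, neg φ => φ.IsQuantifierFree
  | _, half φ => φ.IsQuantifierFree
  | _, dotminus φ ψ => φ.IsQuantifierFree ∧ ψ.IsQuantifierFree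
  | _, inf _ => False
  | _, sup _ => False

/-- The truncated sum `min (φ + ψ) 1`, as the abbreviation `¬(¬φ ∸ ψ)`. -/
def dotplus {n : ℕ} (φ ψ : Formula S n) : Formula S n := neg (dotminus (neg φ) ψ)

/-- The distance `|φ - ψ|`, as the abbreviation `(φ ∸ ψ) ∔ (ψ ∸ φ)`. -/
def absDiff {n : ℕ} (φ ψ : Formula S n) : Formula S n :=
  dotplus (dotminus φ ψ) (dotminus ψ φ)

/-- The half sum `(φ + ψ) / 2`, as the abbreviation `φ / 2 ∔ ψ / 2`. -/
def halfSum {n : ℕ} (φ ψ : Formula S n) : Formula S n := dotplus (half φ) (half ψ)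

/-- The atomic formula `d(s, t)`. -/
def dist {n : ℕ} (s t : S.Tm n) : Formula S n := atom S.distSymb ![s, t]

/-- The sentence `sup_{x_0 … x_{n-1}} φ`. -/
def supAll : ∀ {n : ℕ}, Formula S n → Sentence S
  | 0, φ => φ
  | _ + 1, φ => supAll (sup φ)

end Formula

/-! ### Structures and interpretation -/

/-- Pre-structures: a set with an interpretation of every symbol, such that the distance symbol is
interpreted by a pseudo-metric and every symbol, as a function of each one of its arguments,
respects the prescribed continuity modulus. -/
structure PreStructure (S : Signature) where
  carrier : Type u
  fn : ∀ {n : ℕ}, S.Functions n → (Fin n → carrier) → carrier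
  pred : ∀ {n : ℕ}, S.Relations n → (Fin n → carrier) → I
  dist_self : ∀ x : carrier, pred S.distSymb ![x, x] = 0
  dist_comm : ∀ x y : carrier, pred S.distSymb ![x, y] = pred S.distSymb ![y, x]
  dist_triangle : ∀ x y z : carrier,
    (pred S.distSymb ![x, y] : ℝ) ≤ pred S.distSymb ![x, z] + pred S.distSymb ![z, y]
  fn_respects : ∀ {n : ℕ} (f : S.Functions n) (i : Fin n) (a : Fin n → carrier) (z w : carrier)
    (ε : ℝ), 0 < ε → (pred S.distSymb ![z, w] : ℝ) < S.modFun f i ε →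
      (pred S.distSymb ![fn f (Function.update a i z), fn f (Function.update a i w)] : ℝ) ≤ ε
  pred_respects : ∀ {n : ℕ} (P : S.Relations n) (i : Fin n) (a : Fin n → carrier) (z w : carrier)
    (ε : ℝ), 0 < ε → (pred S.distSymb ![z, w] : ℝ) < S.modRel P i ε →
      |(pred P (Function.update a i z) : ℝ) - pred P (Function.update a i w)| ≤ ε

/-- The interpretation of the distance symbol, with real values. -/
def PreStructure.d {S : Signature} (M : PreStructure.{u} S) (x y : M.carrier) : ℝ :=
  M.pred S.distSymb ![x, y]

/-- Structures: pre-structures in which the distance is a complete metric. -/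
structure CStructure (S : Signature) extends PreStructure.{u} S where
  eq_of_dist_eq_zero : ∀ x y : carrier, toPreStructure.d x y = 0 → x = y
  complete : ∀ a : ℕ → carrier,
    (∀ ε : ℝ, 0 < ε → ∃ N : ℕ, ∀ m n : ℕ, N ≤ m → N ≤ n → toPreStructure.d (a m) (a n) < ε) →
    ∃ x : carrier, ∀ ε : ℝ, 0 < ε → ∃ N : ℕ, ∀ n : ℕ, N ≤ n → toPreStructure.d (a n) x < ε

/-- The interpretation `τ^M(v)` of a term. -/
def PreStructure.evalTm {S : Signature} (M : PreStructure.{u} S) {n : ℕ} (v : Fin n → M.carrier) :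
    S.Tm n → M.carrier
  | .var i => v i
  | .func f ts => M.fn f fun i => M.evalTm v (ts i)

/-- The interpretation `φ^M(v) ∈ [0,1]` of a formula. -/
noncomputable def PreStructure.eval {S : Signature} (M : PreStructure.{u} S) :
    ∀ {n : ℕ}, Formula S n → (Fin n → M.carrier) → I
  | _, .atom P ts, v => M.pred P fun i => M.evalTm v (ts i)
  | _, .neg φ, v => σ (M.eval φ v)
  | _, .half φ, v => halfI (M.eval φ v)
  | _, .dotminus φ ψ, v => dotminusI (M.eval φ v) (M.eval ψ v)
  | n, .inf φ, v => ⨅ b : M.carrier, M.eval φ (Fin.snoc v b : Fin (n + 1) → M.carrier)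
  | n, .sup φ, v => ⨆ b : M.carrier, M.eval φ (Fin.snoc v b : Fin (n + 1) → M.carrier)

/-! ### Theories -/

/-- A theory: a set of sentential conditions `φ = 0`, given as the set of the sentences `φ`. -/
abbrev Theory (S : Signature) : Type := Set (Sentence S)

namespace Theory

variable {S : Signature}

/-- The structure `M` is a model of `T`. -/
def IsModel (M : CStructure.{u} S) (T : Theory S) : Prop :=
  ∀ φ ∈ T, M.eval φ Fin.elim0 = 0

/-- `T` has a model. -/
def IsSatisfiable (T : Theory S) : Prop := ∃ M : CStructure.{u} S, IsModel M T

/-- The sentential conditions that are logical consequences of `T`. -/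
def consequences (T : Theory S) : Theory S :=
  {φ | ∀ M : CStructure.{u} S, IsModel M T → M.eval φ Fin.elim0 = 0}

/-- `T` is complete: its set of logical consequences is maximal among the satisfiable sets of
sentential conditions (in particular it is satisfiable). -/
def IsComplete (T : Theory S) : Prop :=
  Maximal (IsSatisfiable.{u} (S := S)) (consequences.{u} T)

/-- `T` has quantifier elimination: every formula can be uniformly approximated, over all models
of `T`, by quantifier-free formulae in the same free variables. (For signatures that have no
constant symbol one would let the approximations of a sentence have a free variable.) -/
def HasQuantifierElimination (T : Theory S) : Prop :=
  ∀ (n : ℕ) (φ : Formula S n) (ε : ℝ), 0 < ε →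
    ∃ ψ : Formula S n, ψ.IsQuantifierFree ∧
      ∀ M : CStructure.{u} S, IsModel M T → ∀ a : Fin n → M.carrier,
        |(M.eval φ a : ℝ) - M.eval ψ a| ≤ ε

end Theory

/-! ### Atomless probability algebras -/

/-- The function symbols `0, 1, ᶜ, ∧, ∨`. -/
inductive PrFun : ℕ → Type
  | zero : PrFun 0
  | one : PrFun 0
  | compl : PrFun 1
  | meet : PrFun 2
  | join : PrFun 2

/-- The predicate symbols `μ` and `d`. -/
inductive PrRel : ℕ → Type
  | mu : PrRel 1
  | dist : PrRel 2

/-- The signature of probability algebras; all continuity moduli are the identity. -/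
def prSig : Signature where
  Functions := PrFun
  Relations := PrRel
  distSymb := PrRel.dist
  modFun := fun _ _ ε => ε
  modRel := fun _ _ ε => ε
  modFun_pos := fun _ _ _ h => h
  modRel_pos := fun _ _ _ h => h

namespace Pr

/-- The variable `x_i`. -/
def x {n : ℕ} (i : Fin n) : prSig.Tm n := FirstOrder.Language.Term.var i

/-- The constant `0`. -/
def zero {n : ℕ} : prSig.Tm n :=
  FirstOrder.Language.Term.func (L := prSig.toLanguage) PrFun.zero ![]

/-- The constant `1`. -/
def one {n : ℕ} : prSig.Tm n :=
  FirstOrder.Language.Term.func (L := prSig.toLanguage) PrFun.one ![]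

/-- The complement `sᶜ`. -/
def compl {n : ℕ} (s : prSig.Tm n) : prSig.Tm n :=
  FirstOrder.Language.Term.func (L := prSig.toLanguage) PrFun.compl ![s]

/-- The meet `s ∧ t`. -/
def meet {n : ℕ} (s t : prSig.Tm n) : prSig.Tm n :=
  FirstOrder.Language.Term.func (L := prSig.toLanguage) PrFun.meet ![s, t]

/-- The join `s ∨ t`. -/
def join {n : ℕ} (s t : prSig.Tm n) : prSig.Tm n :=
  FirstOrder.Language.Term.func (L := prSig.toLanguage) PrFun.join ![s, t]

/-- The atomic formula `μ(s)`. -/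
def mu {n : ℕ} (s : prSig.Tm n) : Formula prSig n :=
  Formula.atom (S := prSig) PrRel.mu ![s]

/-- The sentence `sup_x̄ d(s, t)`, whose vanishing expresses the equation `s = t`. -/
def eqn {n : ℕ} (s t : prSig.Tm n) : Sentence prSig := (Formula.dist s t).supAll

/-- The equational axioms of Boolean algebras. -/
def booleanAxioms : Theory prSig :=
  {eqn (n := 2) (meet (x 0) (x 1)) (meet (x 1) (x 0)),
   eqn (n := 2) (join (x 0) (x 1)) (join (x 1) (x 0)),
   eqn (n := 3) (meet (meet (x 0) (x 1)) (x 2)) (meet (x 0) (meet (x 1) (x 2))),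
   eqn (n := 3) (join (join (x 0) (x 1)) (x 2)) (join (x 0) (join (x 1) (x 2))),
   eqn (n := 2) (meet (x 0) (join (x 0) (x 1))) (x 0),
   eqn (n := 2) (join (x 0) (meet (x 0) (x 1))) (x 0),
   eqn (n := 3) (meet (x 0) (join (x 1) (x 2))) (join (meet (x 0) (x 1)) (meet (x 0) (x 2))),
   eqn (n := 3) (join (x 0) (meet (x 1) (x 2))) (meet (join (x 0) (x 1)) (join (x 0) (x 2))),
   eqn (n := 1) (meet (x 0) one) (x 0),
   eqn (n := 1) (join (x 0) zero) (x 0),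
   eqn (n := 1) (meet (x 0) (compl (x 0))) zero,
   eqn (n := 1) (join (x 0) (compl (x 0))) one}

/-- `μ(1) = 1`, as `¬ μ(1) = 0`. -/
def muOne : Sentence prSig := Formula.neg (mu one)

/-- `μ(0) = 0`. -/
def muZero : Sentence prSig := mu zero

/-- `sup_{xy} |(μ(x) + μ(y)) / 2 - (μ(x ∨ y) + μ(x ∧ y)) / 2| = 0`. -/
def muModular : Sentence prSig :=
  (Formula.absDiff (n := 2) (Formula.halfSum (mu (x 0)) (mu (x 1)))
    (Formula.halfSum (mu (join (x 0) (x 1))) (mu (meet (x 0) (x 1))))).supAll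

/-- `sup_{xy} |d(x, y) - μ((x ∧ yᶜ) ∨ (y ∧ xᶜ))| = 0`. -/
def distAxiom : Sentence prSig :=
  (Formula.absDiff (n := 2) (Formula.dist (x 0) (x 1))
    (mu (join (meet (x 0) (compl (x 1))) (meet (x 1) (compl (x 0)))))).supAll

/-- `sup_x inf_y |μ(y ∧ x) - μ(x) / 2| = 0`. -/
def atomless : Sentence prSig :=
  Formula.sup (Formula.inf (n := 1)
    (Formula.absDiff (mu (meet (x 1) (x 0))) (Formula.half (mu (x 0)))))

end Pr

/-- The theory of probability algebras. -/
def PrA : Theory prSig :=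
  Pr.booleanAxioms ∪ {Pr.muOne, Pr.muZero, Pr.muModular, Pr.distAxiom}

/-- The theory of atomless probability algebras. -/
def APA : Theory prSig := PrA ∪ {Pr.atomless}

end ContLogic

/-! A model of `APA` is a Boolean algebra with a measure for which every element can be halved
approximately. A tuple `a` of length `n` generates a partition into `2 ^ n` cells, and the vector of
their measures, `typeOf`, is all that a formula can see of `a`: by `exists_continuous_eval_eq`, the
value of each formula is one continuous function of this vector, the same in all models.

The quantifier step rests on a description of the types of the tuples `a, b`. The element `b` cuts
each cell in some ratio, so such a type is `extend p t`, with `p` the type of `a` and `t` a vector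
of ratios (`exists_typeOf_snoc_eq`). Conversely, halving repeatedly, taking relative complements and
passing to limits realises every vector of ratios up to `ε` (`extend_typeOf_mem_closure`). Hence a
quantifier over `b` is an infimum or supremum over `t` in a compact cube, which preserves
continuity.

Cell measures are themselves atomic formulae, and the connectives generate a uniformly dense set of
continuous functions on a finite cube (`mem_of_connectives`); this gives quantifier elimination. For
a sentence there is only one cell, `⊤`, of measure `1`, so its value is the same in all models.
Completeness then needs only one model: the measure algebra of the unit interval. -/

namespace ContLogic

open unitInterval

/-! ### Uniform approximation by connectives -/

/-- A closed subset of `[0,1]` that contains `0` and is stable under `t ↦ t / 2` and `t ↦ 1 - t`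
is all of `[0,1]`. -/
theorem mem_of_half_of_neg (D : Set ℝ) (zero : (0 : ℝ) ∈ D) (half : ∀ t ∈ D, t / 2 ∈ D)
    (neg : ∀ t ∈ D, 1 - t ∈ D)
    (closed : ∀ t ∈ Set.Icc (0 : ℝ) 1, (∀ ε > 0, ∃ t' ∈ D, |t - t'| ≤ ε) → t ∈ D)
    {t : ℝ} (ht : t ∈ Set.Icc (0 : ℝ) 1) : t ∈ D := by
  -- Approximate `2 * t`, or `2 * (1 - t)` when `t` is past `1 / 2`, then halve and reflect back:
  -- each round halves the error.
  have key : ∀ n : ℕ, ∀ t ∈ Set.Icc (0 : ℝ) 1, ∃ t' ∈ D, |t - t'| ≤ (1 / 2) ^ n := by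
    intro n
    induction n with
    | zero =>
      intro t ht
      exact ⟨0, zero, by simpa [abs_of_nonneg ht.1] using ht.2⟩
    | succ n ih =>
      intro t ht
      rcases le_total t (1 / 2) with h | h
      · obtain ⟨s, hs, hst⟩ := ih (2 * t) ⟨by linarith [ht.1], by linarith⟩
        refine ⟨s / 2, half s hs, ?_⟩
        rw [abs_le] at hst ⊢
        rw [pow_succ]
        constructor <;> linarith
      · obtain ⟨s, hs, hst⟩ := ih (2 - 2 * t) ⟨by linarith [ht.2], by linarith⟩
        refine ⟨1 - s / 2, neg _ (half s hs), ?_⟩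
        rw [abs_le] at hst ⊢
        rw [pow_succ]
        constructor <;> linarith
  refine closed t ht fun ε hε => ?_
  obtain ⟨n, hn⟩ := exists_pow_lt_of_lt_one hε (by norm_num : (1 / 2 : ℝ) < 1)
  obtain ⟨s, hs, h⟩ := key n t ht
  exact ⟨s, hs, h.trans hn.le⟩

/-- A uniformly closed set of `[0,1]`-valued functions on a finite cube that contains `0` and the
projections and is stable under the connectives contains every continuous function. -/
theorem mem_of_connectives {ι : Type*} [Fintype ι] (K : Set ((ι → I) → I))
    (zero : (fun _ => 0) ∈ K) (proj : ∀ i, (fun p => p i) ∈ K)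
    (neg : ∀ f ∈ K, (fun p => σ (f p)) ∈ K) (half : ∀ f ∈ K, (fun p => halfI (f p)) ∈ K)
    (dotminus : ∀ f ∈ K, ∀ g ∈ K, (fun p => dotminusI (f p) (g p)) ∈ K)
    (closed : ∀ f : (ι → I) → I,
      (∀ ε : ℝ, 0 < ε → ∃ g ∈ K, ∀ p, |(f p : ℝ) - g p| ≤ ε) → f ∈ K)
    {F : (ι → I) → I} (hF : Continuous F) : F ∈ K := by
  have const : ∀ c : I, (fun _ => c) ∈ K := by
    intro c
    have := mem_of_half_of_neg {t | ∃ h : t ∈ Set.Icc (0 : ℝ) 1, (fun _ => ⟨t, h⟩) ∈ K}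
      ⟨⟨le_rfl, zero_le_one⟩, zero⟩
      (by rintro t ⟨h, ht⟩; exact ⟨(halfI ⟨t, h⟩).2, half _ ht⟩)
      (by rintro t ⟨h, ht⟩; exact ⟨(σ ⟨t, h⟩).2, neg _ ht⟩)
      (by
        intro t h ht
        refine ⟨h, closed _ fun ε hε => ?_⟩
        obtain ⟨s, ⟨h', hs⟩, hst⟩ := ht ε hε
        exact ⟨_, hs, fun _ => hst⟩) c.2
    exact this.2
  have max_mem : ∀ f ∈ K, ∀ g ∈ K, (fun p => f p ⊔ g p) ∈ K := by
    intro f hf g hg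
    convert neg _ (dotminus _ (neg f hf) _ (dotminus g hg f hf)) using 2 with p
    ext
    simp only [dotminusI, unitInterval.coe_symm_eq, Set.Icc.coe_sup]
    have := (g p).2.2
    rcases le_total (f p : ℝ) (g p) with h | h
    · rw [max_eq_right h, max_eq_left (by linarith : 0 ≤ (g p : ℝ) - f p),
        max_eq_left (by linarith)]; ring
    · rw [max_eq_left h, max_eq_right (by linarith : (g p : ℝ) - f p ≤ 0),
        max_eq_left (by have := (f p).2.2; linarith)]; ring
  have sup_mem : ∀ (J : Finset (ι → I)) (f : (ι → I) → (ι → I) → I), (∀ j, f j ∈ K) →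
      (fun p => J.sup fun j => f j p) ∈ K := by
    classical
    intro J f hf
    induction J using Finset.induction_on with
    | empty => exact zero
    | insert j J _ ih => simpa only [Finset.sup_insert] using max_mem _ (hf j) _ ih
  have sub_sum : ∀ (J : Finset ι) (g : ι → (ι → I) → I), (∀ j, g j ∈ K) → ∀ f ∈ K,
      ∃ h ∈ K, ∀ p, (h p : ℝ) = max ((f p : ℝ) - ∑ j ∈ J, (g j p : ℝ)) 0 := by
    classical
    intro J g hg f hf
    induction J using Finset.induction_on with
    | empty => exact ⟨f, hf, fun p => by simp [(f p).2.1]⟩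
    | insert j J hj ih =>
      obtain ⟨h, hh, e⟩ := ih
      refine ⟨_, dotminus h hh (g j) (hg j), fun p => ?_⟩
      have := (g j p).2.1
      simp only [dotminusI, e, Finset.sum_insert hj]
      rcases le_total 0 ((f p : ℝ) - ∑ j ∈ J, (g j p : ℝ)) with h | h
      · rw [max_eq_left h]; congr 1; ring
      · rw [max_eq_right h, max_eq_right (by linarith), max_eq_right (by linarith)]
  -- Cones of slope `N` with peak `c` at `q`. The slope comes from subtracting the two one-sided
  -- distances in each coordinate `N` times.
  have bump : ∀ (q : ι → I) (c : I) (N : ℕ), ∃ h ∈ K, ∀ p,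
      (h p : ℝ) = max ((c : ℝ) - N * ∑ i, |(p i : ℝ) - q i|) 0 := by
    intro q c N
    induction N with
    | zero => exact ⟨_, const c, fun p => by simp [c.2.1]⟩
    | succ N ih =>
      obtain ⟨h, hh, e⟩ := ih
      obtain ⟨h₁, hh₁, e₁⟩ := sub_sum Finset.univ (fun i p => dotminusI (p i) (q i))
        (fun i => dotminus _ (proj i) _ (const (q i))) h hh
      obtain ⟨h₂, hh₂, e₂⟩ := sub_sum Finset.univ (fun i p => dotminusI (q i) (p i))
        (fun i => dotminus _ (const (q i)) _ (proj i)) h₁ hh₁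
      refine ⟨h₂, hh₂, fun p => ?_⟩
      have hs : ∑ i, |(p i : ℝ) - q i| =
          ∑ i, (dotminusI (p i) (q i) : ℝ) + ∑ i, (dotminusI (q i) (p i) : ℝ) := by
        rw [← Finset.sum_add_distrib]
        refine Finset.sum_congr rfl fun i _ => ?_
        simp only [dotminusI]
        rcases le_total (p i : ℝ) (q i) with h | h
        · rw [abs_of_nonpos (by linarith), max_eq_right (by linarith), max_eq_left (by linarith)]
          ring
        · rw [abs_of_nonneg (by linarith), max_eq_left (by linarith), max_eq_right (by linarith)]
          ring
      have n₁ : 0 ≤ ∑ i, (dotminusI (p i) (q i) : ℝ) :=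
        Finset.sum_nonneg fun i _ => (dotminusI (p i) (q i)).2.1
      have n₂ : 0 ≤ ∑ i, (dotminusI (q i) (p i) : ℝ) :=
        Finset.sum_nonneg fun i _ => (dotminusI (q i) (p i)).2.1
      rw [e₂, e₁, e, hs]
      push_cast
      generalize ∑ i, (dotminusI (p i) (q i) : ℝ) = A at *
      generalize ∑ i, (dotminusI (q i) (p i) : ℝ) = B at *
      have r : (c : ℝ) - (N + 1) * (A + B) = c - N * (A + B) - A - B := by ring
      rw [r]
      generalize (c : ℝ) - N * (A + B) = C
      rcases le_total 0 C with h | h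
      · rw [max_eq_left h]
        rcases le_total 0 (C - A) with h' | h'
        · rw [max_eq_left h']
        · rw [max_eq_right h', max_eq_right (by linarith), max_eq_right (by linarith)]
      · rw [max_eq_right h, max_eq_right (a := 0 - A) (by linarith), max_eq_right (by linarith),
          max_eq_right (by linarith)]
  refine closed F fun ε hε => ?_
  obtain ⟨δ, hδ, huc⟩ := Metric.uniformContinuous_iff.1
    (CompactSpace.uniformContinuous_of_continuous hF) (ε / 2) (by linarith)
  -- `F` is approximated by the maximum of cones of height `F q` over a finite net of points `q`.
  -- With slope `N ≥ 1 / δ` a cone vanishes at distance `δ` from its centre; with mesh `η` the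
  -- nearest cone loses at most `ε / 2`. The `+ 1` keeps the denominator positive.
  obtain ⟨N, hN⟩ := exists_nat_ge (1 / δ)
  set η : ℝ := min δ (ε / 2 / (N * Fintype.card ι + 1)) with hη
  have hηpos : 0 < η := by positivity
  obtain ⟨Q, -, hQf, hQ⟩ := (isCompact_univ (X := ι → I)).finite_cover_balls hηpos
  choose h hK he using fun q => bump q (F q) N
  refine ⟨_, sup_mem hQf.toFinset h hK, fun p => ?_⟩
  have habs : ∀ q : ι → I, ∀ i, |(p i : ℝ) - q i| ≤ dist p q := fun q i => dist_le_pi_dist p q i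
  rw [abs_le]
  constructor
  · have ub : (hQf.toFinset.sup fun j => h j p) ≤
        (⟨min ((F p : ℝ) + ε / 2) 1, le_min (by linarith [(F p).2.1]) zero_le_one,
          min_le_right _ _⟩ : I) := by
      refine Finset.sup_le fun q _ => ?_
      rw [← Subtype.coe_le_coe, he]
      refine max_le (le_min ?_ ?_) (le_min (by linarith [(F p).2.1]) zero_le_one)
      · have hnn : 0 ≤ ∑ i, |(p i : ℝ) - q i| := Finset.sum_nonneg fun i _ => abs_nonneg _
        by_cases hd : dist p q < δ
        · have := huc hd
          rw [Subtype.dist_eq, Real.dist_eq, abs_lt] at this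
          nlinarith [N.cast_nonneg (α := ℝ)]
        · rw [dist_pi_lt_iff hδ] at hd
          push Not at hd
          obtain ⟨i, hi⟩ := hd
          have : δ ≤ ∑ i, |(p i : ℝ) - q i| := hi.trans
            (Finset.single_le_sum (f := fun i => |(p i : ℝ) - q i|)
              (fun i _ => abs_nonneg _) (Finset.mem_univ i))
          have h1 : 1 ≤ N * δ := by rwa [div_le_iff₀ hδ] at hN
          nlinarith [N.cast_nonneg (α := ℝ), (F q).2.2, (F p).2.1]
      · have hnn : 0 ≤ N * ∑ i, |(p i : ℝ) - q i| :=
          mul_nonneg N.cast_nonneg (Finset.sum_nonneg fun i _ => abs_nonneg _)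
        linarith [(F q).2.2]
    have := (Subtype.coe_le_coe.2 ub).trans (min_le_left _ _)
    linarith
  · obtain ⟨q, hq, hpq⟩ : ∃ q ∈ Q, dist p q < η := by
      simpa using hQ (Set.mem_univ p)
    have lb : h q p ≤ hQf.toFinset.sup fun j => h j p :=
      Finset.le_sup (f := fun j => h j p) (by simpa using hq)
    have lb' := Subtype.coe_le_coe.2 lb
    rw [he] at lb'
    have lb'' := (le_max_left _ _).trans lb'
    have hs : ∑ i, |(p i : ℝ) - q i| ≤ Fintype.card ι * η := by
      have := Finset.sum_le_card_nsmul Finset.univ (fun i => |(p i : ℝ) - q i|) η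
        fun i _ => (habs q i).trans hpq.le
      simpa using this
    have h1 : N * ∑ i, |(p i : ℝ) - q i| ≤ ε / 2 := by
      have h2 : η * (N * Fintype.card ι + 1) ≤ ε / 2 := by
        rw [← le_div_iff₀ (by positivity)]
        exact min_le_right _ _
      nlinarith [N.cast_nonneg (α := ℝ), mul_le_mul_of_nonneg_left hs (N.cast_nonneg (α := ℝ))]
    have := huc (hpq.trans_le (min_le_left _ _))
    rw [Subtype.dist_eq, Real.dist_eq, abs_lt] at this
    linarith

end ContLogic

/-! ### Translation between models of `APA` and measured Boolean algebras. -/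

namespace ContLogic

open unitInterval
open scoped symmDiff

/-! ### Evaluation of the abbreviations -/

section Eval

variable {S : Signature} (M : PreStructure.{u} S)

theorem eval_dotplus {n : ℕ} (φ ψ : Formula S n) (v : Fin n → M.carrier) :
    (M.eval (φ.dotplus ψ) v : ℝ) = min ((M.eval φ v : ℝ) + M.eval ψ v) 1 := by
  simp only [Formula.dotplus, PreStructure.eval, dotminusI, unitInterval.coe_symm_eq]
  grind

theorem eval_absDiff {n : ℕ} (φ ψ : Formula S n) (v : Fin n → M.carrier) :
    (M.eval (φ.absDiff ψ) v : ℝ) = |(M.eval φ v : ℝ) - M.eval ψ v| := by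
  have h1 := (M.eval φ v).2
  have h2 := (M.eval ψ v).2
  simp only [Formula.absDiff, eval_dotplus, PreStructure.eval, dotminusI]
  simp only [Set.mem_Icc] at h1 h2
  grind

theorem eval_absDiff_eq_zero {n : ℕ} (φ ψ : Formula S n) (v : Fin n → M.carrier) :
    M.eval (φ.absDiff ψ) v = 0 ↔ (M.eval φ v : ℝ) = M.eval ψ v := by
  rw [← Subtype.coe_inj, eval_absDiff, Set.Icc.coe_zero, abs_eq_zero, sub_eq_zero]

theorem eval_halfSum {n : ℕ} (φ ψ : Formula S n) (v : Fin n → M.carrier) :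
    (M.eval (φ.halfSum ψ) v : ℝ) = ((M.eval φ v : ℝ) + M.eval ψ v) / 2 := by
  have h1 := (M.eval φ v).2.2
  have h2 := (M.eval ψ v).2.2
  simp only [Formula.halfSum, eval_dotplus, PreStructure.eval, halfI]
  rw [min_eq_left (by linarith)]
  ring

theorem eval_sup_eq_zero {n : ℕ} (φ : Formula S (n + 1)) (v : Fin n → M.carrier) :
    M.eval (.sup φ) v = 0 ↔ ∀ b, M.eval φ (Fin.snoc v b : Fin (n + 1) → M.carrier) = 0 := by
  simp only [PreStructure.eval]
  exact iSup_eq_bot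

theorem eval_supAll_eq_zero {n : ℕ} (φ : Formula S n) :
    M.eval φ.supAll Fin.elim0 = 0 ↔ ∀ v, M.eval φ v = 0 := by
  induction n with
  | zero => exact ⟨fun h v => by rwa [Subsingleton.elim v Fin.elim0], fun h => h _⟩
  | succ n ih =>
    rw [Formula.supAll, ih]
    simp only [eval_sup_eq_zero]
    exact ⟨fun h v => by simpa using h (Fin.init v) (v (Fin.last n)), fun h v b => h _⟩

theorem eval_dist {n : ℕ} (s t : S.Tm n) (v : Fin n → M.carrier) :
    M.eval (Formula.dist s t) v = M.pred S.distSymb ![M.evalTm v s, M.evalTm v t] := by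
  simp only [Formula.dist, PreStructure.eval]
  congr 1
  ext i
  fin_cases i <;> rfl

end Eval

/-! ### Models of `APA` as Boolean algebras with a measure -/

/-- A normalized, modular function on a Boolean algebra for which every element can be halved
approximately. -/
structure IsAtomlessProbability {B : Type*} [BooleanAlgebra B] (m : B → I) : Prop where
  top : m ⊤ = 1
  bot : m ⊥ = 0
  modular : ∀ x y, (m x : ℝ) + m y = m (x ⊔ y) + m (x ⊓ y)
  atomless : ∀ x, ∀ ε : ℝ, 0 < ε → ∃ y, |(m (y ⊓ x) : ℝ) - m x / 2| ≤ ε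

/-- The symbols of the signature of probability algebras are interpreted by the operations of a
Boolean algebra, and the distance of two elements is the measure of their symmetric difference. -/
structure IsBooleanInterpretation (M : PreStructure.{u} prSig) [BooleanAlgebra M.carrier] :
    Prop where
  zero : ∀ v, M.fn (S := prSig) PrFun.zero v = ⊥
  one : ∀ v, M.fn (S := prSig) PrFun.one v = ⊤
  compl : ∀ v, M.fn (S := prSig) PrFun.compl v = (v 0)ᶜ
  meet : ∀ v, M.fn (S := prSig) PrFun.meet v = v 0 ⊓ v 1
  join : ∀ v, M.fn (S := prSig) PrFun.join v = v 0 ⊔ v 1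
  dist : ∀ v, M.pred (S := prSig) PrRel.dist v = M.pred (S := prSig) PrRel.mu ![v 0 ∆ v 1]

/-- The interpretation of the symbol `μ`. -/
def PreStructure.mu (M : PreStructure.{u} prSig) (x : M.carrier) : I :=
  M.pred (S := prSig) PrRel.mu ![x]

section Tm

variable (M : PreStructure.{u} prSig) {n : ℕ} (v : Fin n → M.carrier)

theorem evalTm_x (i : Fin n) : M.evalTm v (Pr.x i) = v i := rfl

theorem evalTm_zero : M.evalTm v Pr.zero = M.fn (S := prSig) PrFun.zero ![] := by
  simp only [Pr.zero, PreStructure.evalTm]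
  congr 1
  ext i
  exact i.elim0

theorem evalTm_one : M.evalTm v Pr.one = M.fn (S := prSig) PrFun.one ![] := by
  simp only [Pr.one, PreStructure.evalTm]
  congr 1
  ext i
  exact i.elim0

theorem evalTm_compl (s : prSig.Tm n) :
    M.evalTm v (Pr.compl s) = M.fn (S := prSig) PrFun.compl ![M.evalTm v s] := by
  simp only [Pr.compl, PreStructure.evalTm]
  congr 1
  ext i
  fin_cases i; rfl

theorem evalTm_meet (s t : prSig.Tm n) :
    M.evalTm v (Pr.meet s t) = M.fn (S := prSig) PrFun.meet ![M.evalTm v s, M.evalTm v t] := by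
  simp only [Pr.meet, PreStructure.evalTm]
  congr 1
  ext i
  fin_cases i <;> rfl

theorem evalTm_join (s t : prSig.Tm n) :
    M.evalTm v (Pr.join s t) = M.fn (S := prSig) PrFun.join ![M.evalTm v s, M.evalTm v t] := by
  simp only [Pr.join, PreStructure.evalTm]
  congr 1
  ext i
  fin_cases i <;> rfl

theorem eval_mu (s : prSig.Tm n) : M.eval (Pr.mu s) v = M.mu (M.evalTm v s) := by
  simp only [Pr.mu, PreStructure.eval, PreStructure.mu]
  congr 1
  ext i
  fin_cases i; rfl

end Tm

/-- Here it matters that `d` is a metric and not merely a pseudo-metric: distance zero yields true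
equality. -/
theorem eval_eqn_eq_zero (M : CStructure.{u} prSig) {n : ℕ} (s t : prSig.Tm n) :
    M.eval (Pr.eqn s t) Fin.elim0 = 0 ↔ ∀ v, M.evalTm v s = M.evalTm v t := by
  rw [Pr.eqn, eval_supAll_eq_zero]
  refine forall_congr' fun v => ?_
  rw [eval_dist]
  refine ⟨fun h => M.eq_of_dist_eq_zero _ _ ?_, fun h => ?_⟩
  · rw [PreStructure.d, h]; rfl
  · rw [h]; exact M.dist_self _

theorem eval_atomless_eq_zero (M : PreStructure.{u} prSig) :
    M.eval Pr.atomless Fin.elim0 = 0 ↔ ∀ x, ∀ ε : ℝ, 0 < ε → ∃ y,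
      |(M.mu (M.fn (S := prSig) PrFun.meet ![y, x]) : ℝ) - M.mu x / 2| ≤ ε := by
  rw [Pr.atomless, eval_sup_eq_zero]
  refine forall_congr' fun x => ?_
  have e : ∀ y, (M.eval (Formula.absDiff (Pr.mu (Pr.meet (Pr.x 1) (Pr.x 0)))
      (Formula.half (Pr.mu (Pr.x 0)))) (Fin.snoc (Fin.snoc Fin.elim0 x : Fin 1 → M.carrier) y :
        Fin 2 → M.carrier) : ℝ) =
      |(M.mu (M.fn (S := prSig) PrFun.meet ![y, x]) : ℝ) - M.mu x / 2| := by
    intro y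
    rw [eval_absDiff, eval_mu, evalTm_meet, evalTm_x, evalTm_x]
    simp only [PreStructure.eval, eval_mu, halfI, evalTm_x]
    rfl
  simp only [← e]
  simp only [PreStructure.eval]
  constructor
  · intro h ε hε
    -- The threshold has to lie in `I`, hence the cut at `1`.
    have h' := iInf_eq_bot.1 h (⟨min ε 1, by positivity, min_le_right _ _⟩ : I)
      (by rw [bot_lt_iff_ne_bot, ne_eq, ← Subtype.coe_inj]
          exact (by positivity : (0 : ℝ) < min ε 1).ne')
    obtain ⟨y, hy⟩ := h'
    exact ⟨y, (Subtype.coe_lt_coe.2 hy).le.trans (min_le_left _ _)⟩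
  · intro h
    refine iInf_eq_bot.2 fun b hb => ?_
    have hb' : (0 : ℝ) < b := Subtype.coe_lt_coe.2 hb
    obtain ⟨y, hy⟩ := h (b / 2) (by linarith)
    exact ⟨y, Subtype.coe_lt_coe.1 (hy.trans_lt (by linarith))⟩

theorem exists_booleanAlgebra_of_isModel {M : CStructure.{u} prSig}
    (h : Theory.IsModel M APA) : ∃ _ : BooleanAlgebra M.carrier,
      IsBooleanInterpretation M.toPreStructure ∧ IsAtomlessProbability M.mu := by
  have hB : ∀ φ ∈ Pr.booleanAxioms, M.eval φ Fin.elim0 = 0 := fun φ hφ => h φ (.inl (.inl hφ))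
  simp only [Pr.booleanAxioms, Set.mem_insert_iff, Set.mem_singleton_iff, forall_eq_or_imp,
    forall_eq, eval_eqn_eq_zero, evalTm_x, evalTm_zero, evalTm_one, evalTm_compl, evalTm_meet,
    evalTm_join] at hB
  obtain ⟨inf_comm, sup_comm, inf_assoc, sup_assoc, inf_sup, sup_inf, inf_sup_left, sup_inf_left,
    inf_top, sup_bot, inf_compl, sup_compl⟩ := hB
  let _ : Max M.carrier := ⟨fun x y => M.fn (S := prSig) PrFun.join ![x, y]⟩
  let _ : Min M.carrier := ⟨fun x y => M.fn (S := prSig) PrFun.meet ![x, y]⟩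
  let _ : Compl M.carrier := ⟨fun x => M.fn (S := prSig) PrFun.compl ![x]⟩
  let _ : Top M.carrier := ⟨M.fn (S := prSig) PrFun.one ![]⟩
  let _ : Bot M.carrier := ⟨M.fn (S := prSig) PrFun.zero ![]⟩
  let L : Lattice M.carrier := Lattice.mk' (fun a b => sup_comm ![a, b])
    (fun a b c => sup_assoc ![a, b, c]) (fun a b => inf_comm ![a, b])
    (fun a b c => inf_assoc ![a, b, c]) (fun a b => sup_inf ![a, b]) (fun a b => inf_sup ![a, b])
  let D : DistribLattice M.carrier :=
    { L with le_sup_inf := fun a b c => (sup_inf_left ![a, b, c]).ge }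
  let A : BooleanAlgebra M.carrier :=
    { D with
      inf_compl_le_bot := fun a => (inf_compl ![a]).le
      top_le_sup_compl := fun a => (sup_compl ![a]).ge
      le_top := fun a => inf_eq_left.1 (inf_top ![a])
      bot_le := fun a => sup_eq_left.1 (sup_bot ![a]) }
  -- Symbols are interpreted on arbitrary tuples, the operations above on literal ones; these
  -- equations pass from one to the other.
  have eta0 : ∀ v : Fin 0 → M.carrier, v = ![] := fun v => Subsingleton.elim _ _
  have eta1 : ∀ v : Fin 1 → M.carrier, v = ![v 0] := fun v => by ext i; fin_cases i; rfl
  have eta2 : ∀ v : Fin 2 → M.carrier, v = ![v 0, v 1] := fun v => by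
    ext i; fin_cases i <;> rfl
  have hd := h Pr.distAxiom (by simp [APA, PrA])
  have h1 := h Pr.muOne (by simp [APA, PrA])
  have h0 := h Pr.muZero (by simp [APA, PrA])
  have hm := h Pr.muModular (by simp [APA, PrA])
  have ha := h Pr.atomless (by simp [APA, PrA])
  simp only [Pr.distAxiom, Pr.muModular, eval_supAll_eq_zero, eval_absDiff_eq_zero, eval_halfSum,
    eval_mu, eval_dist, evalTm_join, evalTm_meet, evalTm_compl, evalTm_x] at hd hm
  rw [Pr.muZero, eval_mu, evalTm_zero] at h0
  rw [Pr.muOne, PreStructure.eval, eval_mu, evalTm_one, unitInterval.symm_eq_zero] at h1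
  rw [eval_atomless_eq_zero] at ha
  refine ⟨A, ⟨fun v => ?_, fun v => ?_, fun v => ?_, fun v => ?_, fun v => ?_, fun v => ?_⟩,
    ⟨h1, h0, fun x y => ?_, ha⟩⟩
  · rw [eta0 v]; rfl
  · rw [eta0 v]; rfl
  · rw [eta1 v]; rfl
  · rw [eta2 v]; rfl
  · rw [eta2 v]; rfl
  · have := hd v
    rw [Subtype.coe_inj] at this
    conv_lhs => rw [eta2 v]
    exact this
  · have : ((M.mu x : ℝ) + M.mu y) / 2 = ((M.mu (x ⊔ y) : ℝ) + M.mu (x ⊓ y)) / 2 := hm ![x, y]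
    linarith

theorem isModel_of_booleanAlgebra {M : CStructure.{u} prSig} [BooleanAlgebra M.carrier]
    (hM : IsBooleanInterpretation M.toPreStructure) (hm : IsAtomlessProbability M.mu) :
    Theory.IsModel M APA := by
  intro φ hφ
  simp only [APA, PrA, Pr.booleanAxioms, Set.mem_union, Set.mem_insert_iff,
    Set.mem_singleton_iff] at hφ
  rcases hφ with ((hφ | hφ) | hφ)
  · rcases hφ with hφ | hφ | hφ | hφ | hφ | hφ | hφ | hφ | hφ | hφ | hφ | hφ <;> subst hφ <;>
      rw [eval_eqn_eq_zero] <;> intro v <;>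
      simp only [evalTm_x, evalTm_zero, evalTm_one, evalTm_compl, evalTm_meet, evalTm_join,
        hM.zero, hM.one, hM.compl, hM.meet, hM.join, Matrix.cons_val_zero, Matrix.cons_val_one]
    · exact inf_comm _ _
    · exact sup_comm _ _
    · exact inf_assoc _ _ _
    · exact sup_assoc _ _ _
    · exact inf_sup_self
    · exact sup_inf_self
    · exact inf_sup_left _ _ _
    · exact sup_inf_left _ _ _
    · exact inf_top_eq _
    · exact sup_bot_eq _
    · exact inf_compl_eq_bot
    · exact sup_compl_eq_top
  · rcases hφ with hφ | hφ | hφ | hφ <;> subst hφ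
    · rw [Pr.muOne, PreStructure.eval, eval_mu, evalTm_one, hM.one, hm.top]
      exact unitInterval.symm_one
    · rw [Pr.muZero, eval_mu, evalTm_zero, hM.zero, hm.bot]
    · simp only [Pr.muModular, eval_supAll_eq_zero, eval_absDiff_eq_zero, eval_halfSum, eval_mu,
        evalTm_join, evalTm_meet, evalTm_x, hM.meet, hM.join, Matrix.cons_val_zero,
        Matrix.cons_val_one]
      intro v
      rw [hm.modular]
    · simp only [Pr.distAxiom, eval_supAll_eq_zero, eval_absDiff_eq_zero, eval_mu, eval_dist,
        evalTm_join, evalTm_meet, evalTm_compl, evalTm_x, hM.meet, hM.join, hM.compl,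
        Matrix.cons_val_zero, Matrix.cons_val_one]
      intro v
      rw [show prSig.distSymb = PrRel.dist from rfl, hM.dist]
      simp only [symmDiff_eq, Matrix.cons_val_zero, Matrix.cons_val_one]
      rfl
  · subst hφ
    rw [eval_atomless_eq_zero]
    simp only [hM.meet]
    exact hm.atomless

end ContLogic

/-! ### Cells, types of tuples and quantifier elimination. -/

namespace ContLogic

open unitInterval
open scoped symmDiff

/-! ### Measures on Boolean algebras -/

namespace IsAtomlessProbability

variable {B : Type*} [BooleanAlgebra B] {m : B → I} (hm : IsAtomlessProbability m)
include hm

theorem inf_add_inf_compl (x y : B) : (m (x ⊓ y) : ℝ) + m (x ⊓ yᶜ) = m x := by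
  rw [hm.modular, ← inf_sup_left, sup_compl_eq_top, inf_top_eq, ← inf_inf_distrib_left,
    inf_compl_eq_bot, inf_bot_eq, hm.bot]
  simp

theorem mono {x y : B} (h : x ≤ y) : m x ≤ m y := by
  have := hm.inf_add_inf_compl y x
  rw [inf_eq_right.2 h] at this
  rw [← Subtype.coe_le_coe]
  linarith [(m (y ⊓ xᶜ)).2.1]

/-- The ratios `t` that can be realised approximately below every `x` are stable under halving (by
atomlessness), under `1 - t` (by relative complement) and under limits, so `mem_of_half_of_neg`
applies. -/
theorem exists_le_of_mem_Icc {t : ℝ} (ht : t ∈ Set.Icc (0 : ℝ) 1) (x : B) {ε : ℝ} (hε : 0 < ε) :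
    ∃ y ≤ x, |(m y : ℝ) - t * m x| ≤ ε := by
  refine mem_of_half_of_neg
    {t : ℝ | ∀ x, ∀ ε : ℝ, 0 < ε → ∃ y ≤ x, |(m y : ℝ) - t * m x| ≤ ε} ?_ ?_ ?_ ?_ ht x ε hε
  · exact fun x ε hε => ⟨⊥, bot_le, by simpa [hm.bot] using hε.le⟩
  · intro t h x ε hε
    obtain ⟨y, hy, e⟩ := h x ε hε
    obtain ⟨z, hz⟩ := hm.atomless y (ε / 2) (by linarith)
    refine ⟨z ⊓ y, inf_le_right.trans hy, ?_⟩
    rw [abs_le] at *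
    constructor <;> linarith
  · intro t h x ε hε
    obtain ⟨y, hy, e⟩ := h x ε hε
    refine ⟨x ⊓ yᶜ, inf_le_left, ?_⟩
    have := hm.inf_add_inf_compl x y
    rw [inf_eq_right.2 hy] at this
    rw [abs_le] at *
    constructor <;> linarith
  · intro t _ h x ε hε
    obtain ⟨s, hs, hst⟩ := h (ε / 2) (by linarith)
    obtain ⟨y, hy, e⟩ := hs x (ε / 2) (by linarith)
    refine ⟨y, hy, ?_⟩
    have h0 := (m x).2.1
    have h1 := (m x).2.2
    have : |(s - t) * m x| ≤ ε / 2 := by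
      rw [abs_mul, abs_of_nonneg h0, abs_sub_comm]
      nlinarith [abs_nonneg (t - s)]
    calc |(m y : ℝ) - t * m x| = |((m y : ℝ) - s * m x) + (s - t) * m x| := by ring_nf
      _ ≤ _ := abs_add_le _ _
      _ ≤ ε := by linarith

end IsAtomlessProbability

/-! ### Cells -/

/-- The cell of the partition generated by `a` that lies in `a i` for `s i = true` and in the
complement of `a i` for `s i = false`. -/
def cell {B : Type*} [BooleanAlgebra B] : ∀ {n : ℕ}, (Fin n → B) → (Fin n → Bool) → B
  | 0, _, _ => ⊤
  | n + 1, a, s => cell (Fin.init a) (Fin.init s) ⊓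
      if s (Fin.last n) then a (Fin.last n) else (a (Fin.last n))ᶜ

section Cell

variable {B : Type*} [BooleanAlgebra B]

theorem cell_inf {n : ℕ} (a : Fin n → B) (s : Fin n → Bool) (i : Fin n) :
    cell a s ⊓ a i = if s i then cell a s else ⊥ := by
  induction n with
  | zero => exact i.elim0
  | succ n ih =>
    rw [cell]
    refine Fin.lastCases ?_ (fun i => ?_) i
    · split_ifs with h
      · rw [inf_assoc, inf_idem]
      · rw [inf_assoc, compl_inf_self, inf_bot_eq]
    · have := ih (Fin.init a) (Fin.init s) i
      rw [inf_right_comm]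
      change (cell (Fin.init a) (Fin.init s) ⊓ Fin.init a i) ⊓ _ = _
      rw [this]
      change (if s i.castSucc then _ else _) ⊓ _ = _
      by_cases h : s i.castSucc <;> simp [h]

theorem disjoint_cell {n : ℕ} (a : Fin n → B) {s s' : Fin n → Bool} (h : s ≠ s') :
    Disjoint (cell a s) (cell a s') := by
  obtain ⟨i, hi⟩ := Function.ne_iff.1 h
  have h1 := cell_inf a s i
  have h2 := cell_inf a s' i
  rcases hs : s i
  · have hs' : s' i = true := by simpa [hs] using hi.symm
    simp only [hs, hs', if_true, Bool.false_eq_true, if_false] at h1 h2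
    exact (disjoint_iff.2 h1).mono_right (inf_eq_left.1 h2)
  · have hs' : s' i = false := by simpa [hs] using hi.symm
    simp only [hs, hs', if_true, Bool.false_eq_true, if_false] at h1 h2
    exact ((disjoint_iff.2 h2).mono_right (inf_eq_left.1 h1)).symm

/-- Sums over the cells of a longer tuple. -/
theorem sum_snoc {n : ℕ} (f : (Fin (n + 1) → Bool) → ℝ) :
    ∑ s, f s = ∑ s : Fin n → Bool,
      (f (Fin.snoc s true : Fin (n + 1) → Bool) + f (Fin.snoc s false : Fin (n + 1) → Bool)) := by
  rw [← (Fin.snocEquiv fun _ => Bool).sum_comp, Fintype.sum_prod_type_right]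
  simp [Fin.snocEquiv]

theorem IsAtomlessProbability.sum_cell {m : B → I} (hm : IsAtomlessProbability m) {n : ℕ}
    (a : Fin n → B) (x : B) : ∑ s, (m (x ⊓ cell a s) : ℝ) = m x := by
  induction n with
  | zero => simp [cell]
  | succ n ih =>
    rw [sum_snoc, ← ih (Fin.init a)]
    refine Finset.sum_congr rfl fun s _ => ?_
    simp only [cell, Fin.init_snoc, Fin.snoc_last, if_true, Bool.false_eq_true, if_false,
      ← inf_assoc]
    exact hm.inf_add_inf_compl _ _

/-- The operations of a Boolean algebra. -/
def opBool (B : Type*) [BooleanAlgebra B] : ∀ {k : ℕ}, PrFun k → (Fin k → B) → B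
  | _, .zero, _ => ⊥
  | _, .one, _ => ⊤
  | _, .compl, v => (v 0)ᶜ
  | _, .meet, v => v 0 ⊓ v 1
  | _, .join, v => v 0 ⊔ v 1

/-- The value of a term in a Boolean algebra. -/
def evalBool {n : ℕ} (v : Fin n → B) : prSig.Tm n → B
  | .var i => v i
  | .func f ts => opBool B f fun i => evalBool v (ts i)

/-- Evaluating the term at `s` in the two-element algebra `Bool` decides whether the cell lies below
the value of the term or is disjoint from it. -/
theorem cell_inf_evalBool {n : ℕ} (a : Fin n → B) (s : Fin n → Bool) (t : prSig.Tm n) :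
    cell a s ⊓ evalBool a t = if evalBool s t then cell a s else ⊥ := by
  induction t with
  | var i => exact cell_inf a s i
  | func f ts ih =>
    rw [evalBool, evalBool]
    generalize cell a s = c at *
    change PrFun _ at f
    cases f with
    | zero => simp [opBool]
    | one => simp [opBool]
    | compl =>
      have h0 := ih 0
      simp only [opBool]
      by_cases h : evalBool s (ts 0) = true <;> simp only [h] at h0 ⊢
      · rw [← sdiff_eq]
        simpa using h0
      · rw [← sdiff_eq]
        simpa [disjoint_iff] using h0
    | meet =>
      have h0 := ih 0
      have h1 := ih 1
      simp only [opBool]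
      rw [← inf_assoc, h0]
      by_cases h : evalBool s (ts 0) = true <;> simp [h, h1]
    | join =>
      have h0 := ih 0
      have h1 := ih 1
      simp only [opBool]
      rw [inf_sup_left, h0, h1]
      by_cases h : evalBool s (ts 0) = true <;> by_cases h' : evalBool s (ts 1) = true <;>
        simp [h, h']

theorem IsBooleanInterpretation.evalTm_eq {M : PreStructure.{u} prSig} [BooleanAlgebra M.carrier]
    (hM : IsBooleanInterpretation M) {n : ℕ} (v : Fin n → M.carrier) (t : prSig.Tm n) :
    M.evalTm v t = evalBool v t := by
  induction t with
  | var i => rfl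
  | func f ts ih =>
    rw [evalBool, PreStructure.evalTm]
    simp only [ih]
    change PrFun _ at f
    cases f with
    | zero => exact hM.zero _
    | one => exact hM.one _
    | compl => exact hM.compl _
    | meet => exact hM.meet _
    | join => exact hM.join _

end Cell

/-! ### The type of a tuple -/

/-- The term for the cell of the tuple of the variables `x_(g i)`. -/
def cellTerm {n : ℕ} : ∀ {k : ℕ}, (Fin k → Fin n) → (Fin k → Bool) → prSig.Tm n
  | 0, _, _ => Pr.one
  | k + 1, g, s => Pr.meet (cellTerm (Fin.init g) (Fin.init s))
      (if s (Fin.last k) then Pr.x (g (Fin.last k)) else Pr.compl (Pr.x (g (Fin.last k))))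

/-- The measures of the cells of a tuple. -/
noncomputable def typeOf (M : PreStructure.{u} prSig) {n : ℕ} (a : Fin n → M.carrier)
    (s : Fin n → Bool) : I :=
  M.eval (Pr.mu (cellTerm id s)) a

/-- The selection `g` of variables allows an induction on `k` while the number `n` of free variables
stays fixed. -/
theorem IsBooleanInterpretation.evalTm_cellTerm {M : PreStructure.{u} prSig}
    [BooleanAlgebra M.carrier] (hM : IsBooleanInterpretation M) {n k : ℕ} (v : Fin n → M.carrier)
    (g : Fin k → Fin n) (s : Fin k → Bool) :
    M.evalTm v (cellTerm g s) = cell (fun i => v (g i)) s := by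
  induction k with
  | zero => rw [cellTerm, evalTm_one, hM.one, cell]
  | succ k ih =>
    rw [cellTerm, evalTm_meet, hM.meet, cell, Matrix.cons_val_zero, Matrix.cons_val_one, ih]
    congr 1
    split_ifs
    · rfl
    · rw [evalTm_compl, hM.compl]; rfl

theorem IsBooleanInterpretation.typeOf_eq {M : PreStructure.{u} prSig}
    [BooleanAlgebra M.carrier] (hM : IsBooleanInterpretation M) {n : ℕ} (a : Fin n → M.carrier)
    (s : Fin n → Bool) : typeOf M a s = M.mu (cell a s) := by
  rw [typeOf, eval_mu, hM.evalTm_cellTerm]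
  rfl

/-- The type of a tuple with one more element, whose relative measure in the cell `s` of the given
tuple is `t s`. -/
noncomputable def extend {n : ℕ} (p t : (Fin n → Bool) → I) (s : Fin (n + 1) → Bool) : I :=
  if s (Fin.last n) then p (Fin.init s) * t (Fin.init s) else p (Fin.init s) * σ (t (Fin.init s))

theorem continuous_extend {n : ℕ} :
    Continuous fun q : ((Fin n → Bool) → I) × ((Fin n → Bool) → I) => extend q.1 q.2 := by
  refine continuous_pi fun s => ?_
  unfold extend
  split_ifs <;> fun_prop

theorem exists_typeOf_snoc_eq {M : CStructure.{u} prSig} (h : Theory.IsModel M APA) {n : ℕ}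
    (a : Fin n → M.carrier) (b : M.carrier) :
    ∃ t, typeOf M.toPreStructure (Fin.snoc a b : Fin (n + 1) → M.carrier) =
      extend (typeOf M.toPreStructure a) t := by
  obtain ⟨_, hM, hm⟩ := exists_booleanAlgebra_of_isModel h
  have hle : ∀ s, M.mu (cell a s ⊓ b) ≤ M.mu (cell a s) := fun s => hm.mono inf_le_left
  -- The ratio is the conditional measure of `b` in the cell. On a null cell it is `0 / 0 = 0`,
  -- which is harmless since both parts of the cell are null.
  refine ⟨fun s => ⟨(M.mu (cell a s ⊓ b) : ℝ) / M.mu (cell a s),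
    div_nonneg (M.mu _).2.1 (M.mu _).2.1,
    div_le_one_of_le₀ (hle s) (M.mu _).2.1⟩, ?_⟩
  ext s
  have key : (M.mu (cell a (Fin.init s)) : ℝ) *
      ((M.mu (cell a (Fin.init s) ⊓ b) : ℝ) / M.mu (cell a (Fin.init s))) =
        M.mu (cell a (Fin.init s) ⊓ b) := by
    refine mul_div_cancel_of_imp' fun h0 => ?_
    exact le_antisymm ((Subtype.coe_le_coe.2 (hle _)).trans h0.le) (M.mu _).2.1
  have key' := hm.inf_add_inf_compl (cell a (Fin.init s)) b
  rw [hM.typeOf_eq, extend, hM.typeOf_eq, cell, Fin.init_snoc, Fin.snoc_last]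
  split_ifs
  · rw [Set.Icc.coe_mul, key]
  · rw [Set.Icc.coe_mul, unitInterval.coe_symm_eq, mul_sub, key]
    linarith

/-- Choose in each cell a piece of nearly the prescribed measure. The cells being disjoint, the join
of the pieces meets each cell in exactly its piece. Approximate realisation suffices for computing
infima and suprema of continuous functions. -/
theorem extend_typeOf_mem_closure {M : CStructure.{u} prSig} (h : Theory.IsModel M APA) {n : ℕ}
    (a : Fin n → M.carrier) (t : (Fin n → Bool) → I) :
    extend (typeOf M.toPreStructure a) t ∈ closure (Set.range fun b =>
      typeOf M.toPreStructure (Fin.snoc a b : Fin (n + 1) → M.carrier)) := by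
  obtain ⟨_, hM, hm⟩ := exists_booleanAlgebra_of_isModel h
  refine Metric.mem_closure_range_iff.2 fun ε hε => ?_
  choose c hc e using fun s => hm.exists_le_of_mem_Icc (t s).2 (cell a s) (half_pos hε)
  have hcell : ∀ s, cell a s ⊓ Finset.univ.sup c = c s := by
    intro s
    rw [Finset.sup_inf_distrib_left]
    refine le_antisymm (Finset.sup_le fun s' _ => ?_) ?_
    · by_cases hs : s = s'
      · rw [← hs]; exact inf_le_right
      · rw [((disjoint_cell a hs).mono_right (hc s')).eq_bot]; exact bot_le
    · exact (le_inf (hc s) le_rfl).trans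
        (Finset.le_sup (f := fun s' => cell a s ⊓ c s') (Finset.mem_univ s))
  refine ⟨Finset.univ.sup c, (dist_pi_lt_iff hε).2 fun s => ?_⟩
  have key' := hm.inf_add_inf_compl (cell a (Fin.init s)) (Finset.univ.sup c)
  have key := e (Fin.init s)
  rw [hcell] at key'
  rw [hM.typeOf_eq, extend, hM.typeOf_eq, cell, Fin.init_snoc, Fin.snoc_last, Subtype.dist_eq,
    Real.dist_eq]
  rw [abs_le] at key
  rw [abs_lt]
  split_ifs
  · rw [Set.Icc.coe_mul, hcell]
    constructor <;> linarith
  · rw [Set.Icc.coe_mul, unitInterval.coe_symm_eq]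
    constructor <;> linarith

/-! ### Quantifier elimination -/

/-- The ratios `t` range over a compact cube that does not depend on `p`, so the infimum of a
jointly continuous function stays continuous in `p`. -/
theorem continuous_iInf_extend {n : ℕ} {F : ((Fin (n + 1) → Bool) → I) → I} (hF : Continuous F) :
    Continuous fun p : (Fin n → Bool) → I => ⨅ t, F (extend p t) := by
  have := (isCompact_univ (X := (Fin n → Bool) → I)).continuous_sInf
    (f := fun p t => F (extend p t)) (hF.comp continuous_extend)
  simp only [Set.image_univ] at this
  exact this

theorem continuous_iSup_extend {n : ℕ} {F : ((Fin (n + 1) → Bool) → I) → I} (hF : Continuous F) :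
    Continuous fun p : (Fin n → Bool) → I => ⨆ t, F (extend p t) := by
  have := (isCompact_univ (X := (Fin n → Bool) → I)).continuous_sSup
    (f := fun p t => F (extend p t)) (hF.comp continuous_extend)
  simp only [Set.image_univ] at this
  exact this

theorem iInf_eq_of_mem_closure_range {X α β : Type*} [TopologicalSpace X] {f : α → X} {g : β → X}
    {F : X → I} (hF : Continuous F) (hfg : ∀ a, ∃ b, f a = g b)
    (hgf : ∀ b, g b ∈ closure (Set.range f)) : ⨅ a, F (f a) = ⨅ b, F (g b) := by
  refine le_antisymm (le_iInf fun b => ?_) (le_iInf fun a => ?_)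
  · have hc : IsClosed {x | ⨅ a, F (f a) ≤ F x} := isClosed_le continuous_const hF
    have hs : Set.range f ⊆ {x | ⨅ a, F (f a) ≤ F x} :=
      Set.range_subset_iff.2 fun a => iInf_le (fun a => F (f a)) a
    exact closure_minimal hs hc (hgf b)
  · obtain ⟨b, hb⟩ := hfg a
    rw [hb]
    exact iInf_le _ b

theorem iSup_eq_of_mem_closure_range {X α β : Type*} [TopologicalSpace X] {f : α → X} {g : β → X}
    {F : X → I} (hF : Continuous F) (hfg : ∀ a, ∃ b, f a = g b)
    (hgf : ∀ b, g b ∈ closure (Set.range f)) : ⨆ a, F (f a) = ⨆ b, F (g b) := by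
  refine le_antisymm (iSup_le fun a => ?_) (iSup_le fun b => ?_)
  · obtain ⟨b, hb⟩ := hfg a
    rw [hb]
    exact le_iSup (fun b => F (g b)) b
  · have hc : IsClosed {x | F x ≤ ⨆ a, F (f a)} := isClosed_le hF continuous_const
    have hs : Set.range f ⊆ {x | F x ≤ ⨆ a, F (f a)} :=
      Set.range_subset_iff.2 fun a => le_iSup (fun a => F (f a)) a
    exact closure_minimal hs hc (hgf b)

theorem exists_continuous_mu_eq {n : ℕ} (t : prSig.Tm n) :
    ∃ F : ((Fin n → Bool) → I) → I, Continuous F ∧ ∀ M : CStructure.{u} prSig,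
      Theory.IsModel M APA → ∀ a : Fin n → M.carrier,
        M.mu (M.evalTm a t) = F (typeOf M.toPreStructure a) := by
  -- The measure of a term is the sum over the cells below it. The projection only keeps the values
  -- in `[0,1]` at points `p` that are not types, where the sum may exceed `1`.
  refine ⟨fun p => Set.projIcc (0 : ℝ) 1 zero_le_one (∑ s : Fin n → Bool, if evalBool s t then (p s : ℝ) else 0),
    continuous_projIcc.comp (continuous_finsetSum _ fun s _ => by split_ifs <;> fun_prop),
    fun M h a => ?_⟩
  obtain ⟨_, hM, hm⟩ := exists_booleanAlgebra_of_isModel h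
  have : ∑ s : Fin n → Bool, (if evalBool s t then (typeOf M.toPreStructure a s : ℝ) else 0) =
      M.mu (M.evalTm a t) := by
    rw [← hm.sum_cell a, hM.evalTm_eq]
    refine Finset.sum_congr rfl fun s _ => ?_
    rw [inf_comm, cell_inf_evalBool, hM.typeOf_eq]
    split_ifs
    · rfl
    · rw [hm.bot]; rfl
  beta_reduce
  rw [this, Set.projIcc_val]

theorem continuous_halfI : Continuous halfI := by
  unfold halfI
  fun_prop

theorem continuous_dotminusI : Continuous fun p : I × I => dotminusI p.1 p.2 := by
  unfold dotminusI
  fun_prop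

/-- In models of `APA` the value of a formula is a continuous function of the measures of the cells
of the tuple. -/
theorem exists_continuous_eval_eq {n : ℕ} (φ : Formula prSig n) :
    ∃ F : ((Fin n → Bool) → I) → I, Continuous F ∧ ∀ M : CStructure.{u} prSig,
      Theory.IsModel M APA → ∀ a : Fin n → M.carrier,
        M.eval φ a = F (typeOf M.toPreStructure a) := by
  induction φ with
  | @atom n k P ts =>
    change PrRel k at P
    cases P with
    | mu =>
      obtain ⟨F, hF, e⟩ := exists_continuous_mu_eq.{u} (ts 0)
      refine ⟨F, hF, fun M h a => ?_⟩
      rw [← e M h a]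
      change M.pred _ _ = M.pred _ _
      congr 1
      ext i
      fin_cases i; rfl
    | dist =>
      obtain ⟨F, hF, e⟩ := exists_continuous_mu_eq.{u}
        (Pr.join (Pr.meet (ts 0) (Pr.compl (ts 1))) (Pr.meet (ts 1) (Pr.compl (ts 0))))
      refine ⟨F, hF, fun M h a => ?_⟩
      obtain ⟨_, hM, hm⟩ := exists_booleanAlgebra_of_isModel h
      rw [← e M h a]
      refine (hM.dist _).trans ?_
      rw [hM.evalTm_eq, hM.evalTm_eq, hM.evalTm_eq, symmDiff_eq]
      rfl
  | neg φ ih =>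
    obtain ⟨F, hF, e⟩ := ih
    exact ⟨fun p => σ (F p), by fun_prop, fun M h a => by rw [PreStructure.eval, e M h a]⟩
  | half φ ih =>
    obtain ⟨F, hF, e⟩ := ih
    exact ⟨fun p => halfI (F p), continuous_halfI.comp hF,
      fun M h a => by rw [PreStructure.eval, e M h a]⟩
  | dotminus φ ψ ih ih' =>
    obtain ⟨F, hF, e⟩ := ih
    obtain ⟨G, hG, e'⟩ := ih'
    exact ⟨fun p => dotminusI (F p) (G p), continuous_dotminusI.comp (hF.prodMk hG),
      fun M h a => by rw [PreStructure.eval, e M h a, e' M h a]⟩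
  | inf φ ih =>
    obtain ⟨F, hF, e⟩ := ih
    refine ⟨_, continuous_iInf_extend hF, fun M h a => ?_⟩
    simp only [PreStructure.eval, e M h]
    exact iInf_eq_of_mem_closure_range hF (exists_typeOf_snoc_eq h a)
      (extend_typeOf_mem_closure h a)
  | sup φ ih =>
    obtain ⟨F, hF, e⟩ := ih
    refine ⟨_, continuous_iSup_extend hF, fun M h a => ?_⟩
    simp only [PreStructure.eval, e M h]
    exact iSup_eq_of_mem_closure_range hF (exists_typeOf_snoc_eq h a)
      (extend_typeOf_mem_closure h a)

theorem abs_dotminusI_sub_le (x y x' y' : I) :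
    |(dotminusI x y : ℝ) - dotminusI x' y'| ≤ |(x : ℝ) - x'| + |(y : ℝ) - y'| := by
  refine (abs_max_sub_max_le_abs _ _ _).trans ?_
  rw [sub_sub_sub_comm]
  exact abs_sub _ _

/-- The functions of the type that quantifier-free formulae approximate uniformly over all models
satisfy the closure conditions of `mem_of_connectives`; the coordinate functions are the formulae
`μ` of a cell. -/
theorem exists_quantifierFree_approx {n : ℕ} {F : ((Fin n → Bool) → I) → I} (hF : Continuous F)
    {ε : ℝ} (hε : 0 < ε) : ∃ ψ : Formula prSig n, ψ.IsQuantifierFree ∧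
      ∀ M : CStructure.{u} prSig, Theory.IsModel M APA → ∀ a : Fin n → M.carrier,
        |(F (typeOf M.toPreStructure a) : ℝ) - M.eval ψ a| ≤ ε := by
  refine mem_of_connectives {f | ∀ ε : ℝ, 0 < ε → ∃ ψ : Formula prSig n, ψ.IsQuantifierFree ∧
      ∀ M : CStructure.{u} prSig, Theory.IsModel M APA → ∀ a : Fin n → M.carrier,
        |(f (typeOf M.toPreStructure a) : ℝ) - M.eval ψ a| ≤ ε} ?_ ?_ ?_ ?_ ?_ ?_ hF ε hε
  · refine fun ε hε => ⟨Pr.mu Pr.zero, trivial, fun M h a => ?_⟩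
    obtain ⟨_, hM, hm⟩ := exists_booleanAlgebra_of_isModel h
    rw [eval_mu, evalTm_zero, hM.zero, hm.bot, sub_self, abs_zero]
    exact hε.le
  · refine fun s ε hε => ⟨Pr.mu (cellTerm id s), trivial, fun M h a => ?_⟩
    change |(typeOf M.toPreStructure a s : ℝ) - typeOf M.toPreStructure a s| ≤ ε
    rw [sub_self, abs_zero]
    exact hε.le
  · intro f hf ε hε
    obtain ⟨ψ, hψ, e⟩ := hf ε hε
    refine ⟨.neg ψ, hψ, fun M h a => ?_⟩
    simp only [PreStructure.eval, unitInterval.coe_symm_eq]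
    rw [sub_sub_sub_cancel_left, abs_sub_comm]
    exact e M h a
  · intro f hf ε hε
    obtain ⟨ψ, hψ, e⟩ := hf ε hε
    refine ⟨.half ψ, hψ, fun M h a => ?_⟩
    have := e M h a
    simp only [PreStructure.eval, halfI]
    rw [abs_le] at *
    constructor <;> linarith
  · intro f hf g hg ε hε
    obtain ⟨ψ, hψ, e⟩ := hf (ε / 2) (half_pos hε)
    obtain ⟨χ, hχ, e'⟩ := hg (ε / 2) (half_pos hε)
    refine ⟨.dotminus ψ χ, ⟨hψ, hχ⟩, fun M h a => ?_⟩
    simp only [PreStructure.eval]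
    exact (abs_dotminusI_sub_le _ _ _ _).trans (by linarith [e M h a, e' M h a])
  · intro f hf ε hε
    obtain ⟨g, hg, hfg⟩ := hf (ε / 2) (half_pos hε)
    obtain ⟨ψ, hψ, e⟩ := hg (ε / 2) (half_pos hε)
    refine ⟨ψ, hψ, fun M h a => ?_⟩
    exact (abs_sub_le _ _ _).trans (by linarith [e M h a, hfg (typeOf M.toPreStructure a)])

theorem hasQuantifierElimination_APA : Theory.HasQuantifierElimination.{u} APA := by
  intro n φ ε hε
  obtain ⟨F, hF, e⟩ := exists_continuous_eval_eq.{u} φ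
  obtain ⟨ψ, hψ, h⟩ := exists_quantifierFree_approx.{u} hF hε
  exact ⟨ψ, hψ, fun M hM a => by rw [e M hM a]; exact h M hM a⟩

/-- Sentences have the same value in all models of `APA`. -/
theorem eval_sentence_eq {M N : CStructure.{u} prSig} (hM : Theory.IsModel M APA)
    (hN : Theory.IsModel N APA) (φ : Sentence prSig) :
    M.eval φ Fin.elim0 = N.eval φ Fin.elim0 := by
  obtain ⟨F, -, e⟩ := exists_continuous_eval_eq.{u} φ
  rw [e M hM, e N hN]
  congr 1
  ext s
  obtain ⟨_, hM', hm⟩ := exists_booleanAlgebra_of_isModel hM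
  obtain ⟨_, hN', hn⟩ := exists_booleanAlgebra_of_isModel hN
  rw [hM'.typeOf_eq, hN'.typeOf_eq, cell, cell, hm.top, hn.top]

/-- A satisfiable set containing the consequences of `APA` has a model that is a model of `APA`,
where sentences take the same values as in every other one; so it contains nothing but consequences.
-/
theorem isComplete_APA (h : Theory.IsSatisfiable.{u} APA) : Theory.IsComplete.{u} APA := by
  refine ⟨?_, ?_⟩
  · obtain ⟨M, hM⟩ := h
    exact ⟨M, fun φ hφ => hφ M hM⟩
  · rintro T ⟨M, hM⟩ hT φ hφ N hN
    have hA : Theory.IsModel M APA := fun ψ hψ => hM ψ (hT fun N hN => hN ψ hψ)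
    rw [eval_sentence_eq hN hA]
    exact hM φ hφ

end ContLogic

/-! ### Existence of a model. -/

namespace ContLogic

open unitInterval MeasureTheory
open scoped symmDiff ENNReal

/-! ### Structures from measured Boolean algebras -/

section OfBooleanAlgebra

namespace IsAtomlessProbability

variable {B : Type*} [BooleanAlgebra B] {m : B → I} (hm : IsAtomlessProbability m)
include hm

theorem sup_le_add (x y : B) : (m (x ⊔ y) : ℝ) ≤ m x + m y := by
  linarith [hm.modular x y, (m (x ⊓ y)).2.1]

theorem symmDiff_triangle (x y z : B) : (m (x ∆ y) : ℝ) ≤ m (x ∆ z) + m (z ∆ y) :=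
  (Subtype.coe_le_coe.2 (hm.mono (_root_.symmDiff_triangle x z y))).trans (hm.sup_le_add _ _)

theorem abs_sub_le_symmDiff (x y : B) : |(m x : ℝ) - m y| ≤ m (x ∆ y) := by
  have h1 := hm.symmDiff_triangle x ⊥ y
  have h2 := hm.symmDiff_triangle y ⊥ x
  rw [symmDiff_comm y x] at h2
  simp only [symmDiff_bot] at h1 h2
  rw [abs_le]
  constructor <;> linarith

end IsAtomlessProbability

/-- The interpretation of the predicate symbols by a function on a Boolean algebra. -/
def predBool {B : Type*} [BooleanAlgebra B] (m : B → I) : ∀ {k : ℕ}, PrRel k → (Fin k → B) → I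
  | _, .mu, v => m (v 0)
  | _, .dist, v => m (v 0 ∆ v 1)

/-- Together with monotonicity of the measure this gives the identity as continuity modulus of every
operation. Joins reduce to meets by complementation. -/
theorem opBool_update_symmDiff_le {B : Type*} [BooleanAlgebra B] {k : ℕ} (f : PrFun k) (i : Fin k)
    (a : Fin k → B) (z w : B) :
    opBool B f (Function.update a i z) ∆ opBool B f (Function.update a i w) ≤ z ∆ w := by
  have hinf : ∀ b : B, (z ⊓ b) ∆ (w ⊓ b) ≤ z ∆ w := fun b => by
    rw [← inf_symmDiff_distrib_right]; exact inf_le_left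
  have hsup : ∀ b : B, (z ⊔ b) ∆ (w ⊔ b) ≤ z ∆ w := fun b => by
    rw [← compl_symmDiff_compl, compl_sup, compl_sup, ← inf_symmDiff_distrib_right,
      compl_symmDiff_compl]
    exact inf_le_left
  cases f with
  | zero => exact i.elim0
  | one => exact i.elim0
  | compl => fin_cases i; simp [opBool]
  | meet =>
    fin_cases i
    · simpa [opBool] using hinf (a 1)
    · simpa [opBool, inf_comm] using hinf (a 0)
  | join =>
    fin_cases i
    · simpa [opBool] using hsup (a 1)
    · simpa [opBool, sup_comm] using hsup (a 0)

theorem abs_predBool_update_sub_le {B : Type*} [BooleanAlgebra B] {m : B → I}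
    (hm : IsAtomlessProbability m) {k : ℕ} (P : PrRel k) (i : Fin k) (a : Fin k → B) (z w : B) :
    |(predBool m P (Function.update a i z) : ℝ) - predBool m P (Function.update a i w)| ≤
      m (z ∆ w) := by
  have hd : ∀ b : B, |(m (z ∆ b) : ℝ) - m (w ∆ b)| ≤ m (z ∆ w) := fun b => by
    have := hm.abs_sub_le_symmDiff (z ∆ b) (w ∆ b)
    rwa [symmDiff_symmDiff_symmDiff_comm, symmDiff_self, symmDiff_bot] at this
  cases P with
  | mu => fin_cases i; simpa [predBool] using hm.abs_sub_le_symmDiff z w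
  | dist =>
    fin_cases i
    · simpa [predBool] using hd (a 1)
    · simpa [predBool, symmDiff_comm] using hd (a 0)

/-- The structure given by a Boolean algebra with a strictly positive complete measure. -/
def ofBooleanAlgebra {B : Type u} [BooleanAlgebra B] {m : B → I} (hm : IsAtomlessProbability m)
    (pos : ∀ x, m x = 0 → x = ⊥)
    (complete : ∀ a : ℕ → B,
      (∀ ε : ℝ, 0 < ε → ∃ N : ℕ, ∀ i j : ℕ, N ≤ i → N ≤ j → (m (a i ∆ a j) : ℝ) < ε) →
      ∃ x : B, ∀ ε : ℝ, 0 < ε → ∃ N : ℕ, ∀ n : ℕ, N ≤ n → (m (a n ∆ x) : ℝ) < ε) :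
    CStructure.{u} prSig where
  carrier := B
  fn f v := opBool B f v
  pred P v := predBool m P v
  dist_self x := by
    change m (x ∆ x) = 0
    rw [symmDiff_self, hm.bot]
  dist_comm x y := by
    change m (x ∆ y) = m (y ∆ x)
    rw [symmDiff_comm]
  dist_triangle := hm.symmDiff_triangle
  fn_respects f i a z w ε _ h :=
    (Subtype.coe_le_coe.2 (hm.mono (opBool_update_symmDiff_le f i a z w))).trans h.le
  pred_respects P i a z w ε _ h := (abs_predBool_update_sub_le hm P i a z w).trans h.le
  eq_of_dist_eq_zero x y h := symmDiff_eq_bot.1 (pos _ (by apply Subtype.ext; exact h))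
  complete := by exact complete

theorem isModel_ofBooleanAlgebra {B : Type u} [inst : BooleanAlgebra B] {m : B → I}
    (hm : IsAtomlessProbability m) (pos) (complete) :
    Theory.IsModel (ofBooleanAlgebra hm pos complete) APA := by
  let _ : BooleanAlgebra (ofBooleanAlgebra hm pos complete).carrier := inst
  exact isModel_of_booleanAlgebra ⟨fun _ => rfl, fun _ => rfl, fun _ => rfl, fun _ => rfl,
    fun _ => rfl, fun _ => rfl⟩ hm

end OfBooleanAlgebra

/-! ### The measure algebra of the unit interval -/

section MeasureAlgebra

/-- A rapidly Cauchy sequence of sets converges to its limes superior, as in the Borel–Cantelli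
lemma. -/
theorem completeSpace_measuredSets {α : Type*} [MeasurableSpace α] (μ : Measure α) :
    CompleteSpace (MeasuredSets μ) := by
  refine EMetric.complete_of_convergent_controlled_sequences (fun n => (2⁻¹ : ℝ≥0∞) ^ n)
    (fun n => ENNReal.pow_pos (by simp) n) fun u hu => ?_
  have hmeas : ∀ n, MeasurableSet (u n : Set α) := fun n => (u n).2
  let l : MeasuredSets μ := ⟨⋂ n, ⋃ k, (u (n + k) : Set α),
    .iInter fun n => .iUnion fun k => hmeas _⟩
  refine ⟨l, ?_⟩
  rw [tendsto_iff_edist_tendsto_0]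
  -- A point whose membership never changes from index `n` on belongs to the limes superior exactly
  -- when it belongs to `u n`.
  have hsub : ∀ n, (u n : Set α) ∆ (⋂ n, ⋃ k, (u (n + k) : Set α)) ⊆
      ⋃ k, (u (n + k) : Set α) ∆ (u (n + k + 1) : Set α) := by
    intro n x hx
    by_contra hc
    simp only [Set.mem_iUnion, not_exists, Set.mem_symmDiff] at hc
    have step : ∀ k, x ∈ u (n + k) ↔ x ∈ u n := by
      intro k
      induction k with
      | zero => rfl
      | succ k ih =>
        rw [← ih]
        have := hc k
        rw [← add_assoc]
        simp only [SetLike.mem_coe] at this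
        tauto
    simp only [Set.mem_symmDiff, Set.mem_iInter, Set.mem_iUnion, SetLike.mem_coe, not_forall,
      not_exists] at hx
    rcases hx with ⟨h, l, hl⟩ | ⟨h, h'⟩
    · refine hl n ?_
      rw [add_comm]
      exact (step l).2 h
    · obtain ⟨k, hk⟩ := h n
      exact h' ((step k).1 hk)
  have hbound : ∀ n, edist (u n) l ≤ 2⁻¹ ^ n * 2 := by
    intro n
    refine (measure_mono (hsub n)).trans ((measure_iUnion_le _).trans ?_)
    calc ∑' k, μ ((u (n + k) : Set α) ∆ (u (n + k + 1) : Set α))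
        ≤ ∑' k, (2⁻¹ : ℝ≥0∞) ^ (n + k) :=
          ENNReal.tsum_le_tsum fun k => (hu (n + k) (n + k) (n + k + 1) le_rfl (by omega)).le
      _ = 2⁻¹ ^ n * 2 := by
          simp_rw [pow_add]
          rw [ENNReal.tsum_mul_left, ENNReal.tsum_geometric, ENNReal.one_sub_inv_two, inv_inv]
  refine tendsto_of_tendsto_of_tendsto_of_le_of_le tendsto_const_nhds ?_ (fun _ => zero_le) hbound
  have := ENNReal.Tendsto.mul_const (b := 2)
    (ENNReal.tendsto_pow_atTop_nhds_zero_of_lt_one (r := 2⁻¹) (by simp)) (.inr (by simp))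
  simpa using this

/-- The uniform distribution on the unit interval. -/
noncomputable def unitMeasure : Measure ℝ := volume.restrict (Set.Icc 0 1)

instance : IsProbabilityMeasure unitMeasure := ⟨by simp [unitMeasure]⟩

/-- The function `r ↦ unitMeasure.real (Set.Iic r ∩ s)` is 1-Lipschitz and rises from `0` to the
full measure on `[0,1]`; the intermediate value theorem gives the cut. -/
theorem exists_measurableSet_inter_half (s : Set ℝ) :
    ∃ t, MeasurableSet t ∧ unitMeasure.real (t ∩ s) = unitMeasure.real s / 2 := by
  have hlip : LipschitzWith 1 fun r : ℝ => unitMeasure.real (Set.Iic r ∩ s) := by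
    refine LipschitzWith.of_le_add fun r r' => ?_
    have hsub : Set.Iic r ∩ s ⊆ (Set.Iic r' ∩ s) ∪ Set.Ioc r' r := by
      rintro x ⟨hx, hxs⟩
      rcases le_or_gt x r' with h | h
      · exact .inl ⟨h, hxs⟩
      · exact .inr ⟨h, hx⟩
    refine (measureReal_mono hsub).trans ((measureReal_union_le _ _).trans ?_)
    gcongr
    refine ENNReal.toReal_le_of_le_ofReal dist_nonneg ?_
    refine (Measure.restrict_apply_le _ _).trans ?_
    rw [Real.volume_Ioc]
    exact ENNReal.ofReal_le_ofReal (le_abs_self _)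
  have h0 : unitMeasure.real (Set.Iic 0 ∩ s) = 0 := by
    have : unitMeasure (Set.Iic 0) = 0 := by
      rw [unitMeasure, Measure.restrict_apply measurableSet_Iic]
      refine measure_mono_null (t := {0}) ?_ (by simp)
      rintro x ⟨hx, hx', -⟩
      exact le_antisymm hx hx'
    rw [measureReal_def, measure_mono_null Set.inter_subset_left this, ENNReal.toReal_zero]
  have h1 : unitMeasure.real (Set.Iic 1 ∩ s) = unitMeasure.real s := by
    refine measureReal_congr ?_
    have : ∀ᵐ x ∂unitMeasure, x ∈ Set.Icc (0 : ℝ) 1 := ae_restrict_mem measurableSet_Icc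
    filter_upwards [this] with x hx
    exact propext ⟨fun h => h.2, fun h => ⟨hx.2, h⟩⟩
  have hnn : 0 ≤ unitMeasure.real s := measureReal_nonneg
  obtain ⟨r, -, hr⟩ := intermediate_value_Icc zero_le_one hlip.continuous.continuousOn
    (show unitMeasure.real s / 2 ∈ _ by
      rw [h0, h1]
      constructor <;> linarith)
  exact ⟨Set.Iic r, measurableSet_Iic, hr⟩

/-- Equality of measurable sets up to a null set. -/
def nullSetoid : Setoid {s : Set ℝ // MeasurableSet s} where
  r s t := (s : Set ℝ) =ᵐ[unitMeasure] (t : Set ℝ)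
  iseqv := ⟨fun _ => .rfl, fun h => h.symm, fun h h' => h.trans h'⟩

/-- The measurable sets of the unit interval up to null sets. -/
def UnitMeasureAlgebra : Type := Quotient nullSetoid

namespace UnitMeasureAlgebra

instance : Compl UnitMeasureAlgebra :=
  ⟨Quotient.map (·ᶜ) fun _ _ h => Filter.EventuallyEq.compl h⟩

instance : Lattice UnitMeasureAlgebra :=
  @Lattice.mk' _ ⟨Quotient.map₂ (· ⊔ ·) fun _ _ h _ _ h' => Filter.EventuallyEq.union h h'⟩
    ⟨Quotient.map₂ (· ⊓ ·) fun _ _ h _ _ h' => Filter.EventuallyEq.inter h h'⟩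
    (by rintro ⟨a⟩ ⟨b⟩; exact congrArg (Quotient.mk _) (sup_comm a b))
    (by rintro ⟨a⟩ ⟨b⟩ ⟨c⟩; exact congrArg (Quotient.mk _) (sup_assoc a b c))
    (by rintro ⟨a⟩ ⟨b⟩; exact congrArg (Quotient.mk _) (inf_comm a b))
    (by rintro ⟨a⟩ ⟨b⟩ ⟨c⟩; exact congrArg (Quotient.mk _) (inf_assoc a b c))
    (by rintro ⟨a⟩ ⟨b⟩; exact congrArg (Quotient.mk _) (sup_inf_self (a := a) (b := b)))
    (by rintro ⟨a⟩ ⟨b⟩; exact congrArg (Quotient.mk _) (inf_sup_self (a := a) (b := b)))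

instance : DistribLattice UnitMeasureAlgebra where
  le_sup_inf := by
    rintro ⟨a⟩ ⟨b⟩ ⟨c⟩
    exact le_of_eq (congrArg (Quotient.mk _) (sup_inf_left a b c).symm)

instance : BooleanAlgebra UnitMeasureAlgebra where
  top := Quotient.mk _ ⊤
  bot := Quotient.mk _ ⊥
  inf_compl_le_bot := by
    rintro ⟨a⟩; exact le_of_eq (congrArg (Quotient.mk _) (inf_compl_eq_bot (a := a)))
  top_le_sup_compl := by
    rintro ⟨a⟩; exact le_of_eq (congrArg (Quotient.mk _) (sup_compl_eq_top (x := a)).symm)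
  le_top := by
    rintro ⟨a⟩; exact inf_eq_left.1 (congrArg (Quotient.mk _) (inf_top_eq a))
  bot_le := by
    rintro ⟨a⟩; exact sup_eq_left.1 (congrArg (Quotient.mk _) (sup_bot_eq a))

/-- The measure of an element of the measure algebra. -/
noncomputable def measure : UnitMeasureAlgebra → I :=
  Quotient.lift (fun s => ⟨unitMeasure.real (s : Set ℝ), measureReal_nonneg, measureReal_le_one⟩)
    fun _ _ h => Subtype.ext (measureReal_congr h)

theorem isAtomlessProbability_measure : IsAtomlessProbability measure where
  top := Subtype.ext (by change unitMeasure.real Set.univ = 1; simp)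
  bot := Subtype.ext (by change unitMeasure.real ∅ = 0; simp)
  modular := by
    rintro ⟨s⟩ ⟨t⟩
    exact (measureReal_union_add_inter t.2).symm
  atomless := by
    rintro ⟨s⟩ ε hε
    obtain ⟨t, ht, e⟩ := exists_measurableSet_inter_half (s : Set ℝ)
    refine ⟨Quotient.mk _ ⟨t, ht⟩, ?_⟩
    change |unitMeasure.real (t ∩ s) - unitMeasure.real s / 2| ≤ ε
    rw [e, sub_self, abs_zero]
    exact hε.le

theorem eq_bot_of_measure_eq_zero (x : UnitMeasureAlgebra) (h : measure x = 0) : x = ⊥ := by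
  obtain ⟨s⟩ := x
  have h' : unitMeasure.real (s : Set ℝ) = 0 := congrArg Subtype.val h
  exact Quotient.sound (ae_eq_empty.2 ((measureReal_eq_zero_iff).1 h'))

/-- The class of a measurable set. -/
def mk (s : MeasuredSets unitMeasure) : UnitMeasureAlgebra :=
  Quotient.mk nullSetoid ⟨s, s.2⟩

theorem exists_mk_eq (x : UnitMeasureAlgebra) : ∃ s, mk s = x := by
  obtain ⟨s⟩ := x
  exact ⟨⟨s.1, s.2⟩, rfl⟩

/-- This carries the completeness of `MeasuredSets unitMeasure` over to the quotient by null sets.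
-/
theorem measure_symmDiff_mk (s t : MeasuredSets unitMeasure) :
    (measure (mk s ∆ mk t) : ℝ) = dist s t := by
  rw [symmDiff_eq, MeasuredSets.dist_def, Set.symmDiff_def, Set.sdiff_eq, Set.sdiff_eq]
  rfl

theorem complete (a : ℕ → UnitMeasureAlgebra)
    (h : ∀ ε : ℝ, 0 < ε → ∃ N : ℕ, ∀ i j : ℕ, N ≤ i → N ≤ j → (measure (a i ∆ a j) : ℝ) < ε) :
    ∃ x, ∀ ε : ℝ, 0 < ε → ∃ N : ℕ, ∀ n : ℕ, N ≤ n → (measure (a n ∆ x) : ℝ) < ε := by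
  choose s hs using fun n => exists_mk_eq (a n)
  have hC : CauchySeq s := Metric.cauchySeq_iff.2 fun ε hε => by
    obtain ⟨N, hN⟩ := h ε hε
    refine ⟨N, fun i hi j hj => ?_⟩
    rw [← measure_symmDiff_mk, hs, hs]
    exact hN i j hi hj
  have := completeSpace_measuredSets unitMeasure
  obtain ⟨x, hx⟩ := cauchySeq_tendsto_of_complete hC
  refine ⟨mk x, fun ε hε => ?_⟩
  obtain ⟨N, hN⟩ := Metric.tendsto_atTop.1 hx ε hε
  refine ⟨N, fun n hn => ?_⟩
  rw [← hs, measure_symmDiff_mk]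
  exact hN n hn

end UnitMeasureAlgebra

theorem isSatisfiable_APA : Theory.IsSatisfiable.{u} APA := by
  -- The measure algebra lives in the lowest universe, so it is lifted to obtain a model in universe
  -- `u`.
  let _ : BooleanAlgebra (ULift.{u} UnitMeasureAlgebra) :=
    { (inferInstance : DistribLattice (ULift.{u} UnitMeasureAlgebra)) with
      compl := fun x => ⟨x.downᶜ⟩
      top := ⟨⊤⟩
      bot := ⟨⊥⟩
      inf_compl_le_bot := fun x => BooleanAlgebra.inf_compl_le_bot x.down
      top_le_sup_compl := fun x => BooleanAlgebra.top_le_sup_compl x.down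
      le_top := fun x => le_top (a := x.down)
      bot_le := fun x => bot_le (a := x.down) }
  have hsymm : ∀ x y : ULift.{u} UnitMeasureAlgebra, (x ∆ y).down = x.down ∆ y.down := by
    intro x y
    rw [symmDiff_eq, symmDiff_eq]
    rfl
  have hμ := UnitMeasureAlgebra.isAtomlessProbability_measure
  have hm : IsAtomlessProbability
      fun x : ULift.{u} UnitMeasureAlgebra => UnitMeasureAlgebra.measure x.down :=
    ⟨hμ.top, hμ.bot, fun x y => hμ.modular x.down y.down, fun x ε hε => by
      obtain ⟨y, hy⟩ := hμ.atomless x.down ε hε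
      exact ⟨⟨y⟩, hy⟩⟩
  refine ⟨_, isModel_ofBooleanAlgebra hm
    (fun x hx => ULift.ext _ _ (UnitMeasureAlgebra.eq_bot_of_measure_eq_zero x.down hx))
    fun a ha => ?_⟩
  simp only [hsymm] at ha ⊢
  obtain ⟨x, hx⟩ := UnitMeasureAlgebra.complete (fun n => (a n).down) ha
  exact ⟨⟨x⟩, hx⟩

end MeasureAlgebra

end ContLogic

theorem mainTheorem10 :
    ContLogic.Theory.IsComplete.{u} ContLogic.APA ∧
      ContLogic.Theory.HasQuantifierElimination.{u} ContLogic.APA :=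
  ⟨ContLogic.isComplete_APA ContLogic.isSatisfiable_APA, ContLogic.hasQuantifierElimination_APA⟩
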